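/- **Setting.** Let $\mathcal X$ be a measurable space and let $\langle \mathcal D_S,f_S\rangle$, $\langle \mathcal D_T,f_T\rangle$ be a source and a target domain: $\mathcal D_S,\mathcal D_T$ are probability distributions on $\mathcal X$ and $f_S,f_T:\mathcal X\to[0,1]$ are labeling functions. Let $\mathcal H\subseteq[0,1]^{\mathcal X}$ be a class of measurable functions that contains $f_S$ and $f_T$. Put $$\tilde{\mathcal H}=\{x\mapsto \mathrm{sgn}(|h(x)-h'(x)|-t)\;:\;h,h'\in\mathcal H,\ t\in[0,1]\},$$ where $\mathrm{sgn}(z)=1$ for $z>0$ and $\mathrm{sgn}(z)=0$ for $z\le 0$, so that $\tilde{\mathcal H}$ is a class of $\{0,1\}$-valued hypotheses. Assume the usual measurability condition that for all $k\in\mathbb N$ and $a\in\mathbb R^k$ the map $(x_1,\dots,x_k)\mapsto\sup_{g\in\tilde{\mathcal H}}\sum_{i=1}^k a_i g(x_i)$ is measurable on $\mathcal X^k$. **Notation.** Let $\varepsilon_T(h)=\mathbb E_{x\sim\mathcal D_T}|h(x)-f_T(x)|$. For a class $\mathcal F$ of functions and distributions $\mathcal D,\mathcal D'$, let $d_{\mathcal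 F}(\mathcal D,\mathcal D')=\sup_{h\in\mathcal F}|\mathcal D(h^{-1}(1))-\mathcal D'(h^{-1}(1))|$. For a finite sample $\mathbf S=(x_1,\dots,x_m)$ let $\mathrm{Rad}_{\mathbf S}(\mathcal F)=\mathbb E_{\sigma}\big[\sup_{h\in\mathcal F}\frac1m\sum_{i=1}^m\sigma_i h(x_i)\big]$, where the $\sigma_i$ are i.i.d. uniform on $\{+1,-1\}$. Let $n\ge1$, let $\mathbf S_S=(x_1,\dots,x_n)$ be i.i.d. from $\mathcal D_S$ and $\mathbf S_T=(x'_1,\dots,x'_n)$ i.i.d. from $\mathcal D_T$ (independence between the two samples is not required). Let $\widehat{\mathcal D}_S,\widehat{\mathcal D}_T$ be their empirical distributions, let $\mathbf S=\{\mathbf S_S,\mathbf S_T\}$ be the pooled sample of size $2n$, and let $\widehat\varepsilon_S(h)=\frac1n\sum_{i=1}^n|h(x_i)-f_S(x_i)|$. **Theorem.** There is an absolute constant $C>0$ such that in every such setting, for every $n\ge1$ and every $\delta\in(0,1)$, with probability at least $1-\delta$ over the samples, every $h\in\mathcal H$ satisfies $$\varepsilon_T(h)\le \widehat\varepsilon_S(h)+d_{\tilde{\mathcal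 H}}(\widehat{\mathcal D}_S,\widehat{\mathcal D}_T)+2\,\mathrm{Rad}_{\mathbf S}(\mathcal H)+4\,\mathrm{Rad}_{\mathbf S}(\tilde{\mathcal H})+\min\{\mathbb E_{\mathcal D_S}|f_S-f_T|,\ \mathbb E_{\mathcal D_T}|f_S-f_T|\}+C\sqrt{\frac{\log(1/\delta)}{n}},$$ and also the same inequality with $2\,\mathrm{Rad}_{\mathbf S}(\mathcal H)+4\,\mathrm{Rad}_{\mathbf S}(\tilde{\mathcal H})$ replaced by $2\,\mathrm{Rad}_{\mathbf S_S}(\mathcal H)+2\,\mathrm{Rad}_{\mathbf S_S}(\tilde{\mathcal H})+2\,\mathrm{Rad}_{\mathbf S_T}(\tilde{\mathcal H})$. (Precisely: the set of outcomes where one of the two inequalities fails for some $h\in\mathcal H$ has outer probability at most $\delta$.) -/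

import Mathlib

open MeasureTheory ProbabilityTheory

noncomputable section

namespace DomainAdaptation

variable {X : Type*}

/-- The error `ε_D(h, f) = 𝔼_{x ∼ D} |h x - f x|` of `h` with respect to the labeling function
`f` under the distribution `D`. -/
def risk [MeasurableSpace X] (D : Measure X) (h f : X → ℝ) : ℝ :=
  ∫ x, |h x - f x| ∂D

/-- The empirical error of `h` with respect to `f` on a sample of size `n`. -/
def empRisk {n : ℕ} (x : Fin n → X) (h f : X → ℝ) : ℝ :=
  (1 / (n : ℝ)) * ∑ i, |h (x i) - f (x i)|

/-- The empirical distribution of a sample of size `n`: mass `1 / n` at every sample point. -/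
def empMeasure [MeasurableSpace X] {n : ℕ} (x : Fin n → X) : Measure X :=
  (n : ENNReal)⁻¹ • ∑ i, Measure.dirac (x i)

/-- The collection `{h⁻¹(1) | h ∈ F}` of supports of the hypotheses of a class `F`. -/
def supports (F : Set (X → ℝ)) : Set (Set X) :=
  {A | ∃ h ∈ F, A = h ⁻¹' {1}}

/-- The divergence `d_F(D, D') = sup_A |D(A) - D'(A)|`, where `A` ranges over the supports of the
hypotheses of `F`. -/
def divergence [MeasurableSpace X] (F : Set (X → ℝ)) (D D' : Measure X) : ℝ :=
  ⨆ A : supports F, |D.real A - D'.real A|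

/-- The sign as a binary decision: `1` on positive reals, `0` elsewhere. -/
def binSgn (z : ℝ) : ℝ := if 0 < z then 1 else 0

/-- The hypothesis class of all `x ↦ sgn (|h x - h' x| - t)` with `h, h' ∈ H` and `0 ≤ t ≤ 1`. -/
def thresholdClass (H : Set (X → ℝ)) : Set (X → ℝ) :=
  {g | ∃ h ∈ H, ∃ h' ∈ H, ∃ t ∈ Set.Icc (0 : ℝ) 1, g = fun x => binSgn (|h x - h' x| - t)}

/-- The empirical Rademacher complexity `𝔼_σ [sup_{h ∈ F} (1/m) ∑ i, σ i * h (x i)]` of the class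
`F` on a sample `x` of size `m`, here indexed by a finite type `ι` with `m` elements. The signs
`σ i` are i.i.d. uniform on `{+1, -1} = ℤˣ`, so the expectation is the average over all sign
vectors. -/
def rademacher {ι : Type*} [Fintype ι] [DecidableEq ι] (F : Set (X → ℝ)) (x : ι → X) : ℝ :=
  (1 / (Fintype.card (ι → ℤˣ) : ℝ)) *
    ∑ σ : ι → ℤˣ, ⨆ h : F, (1 / (Fintype.card ι : ℝ)) * ∑ i, ((σ i : ℤ) : ℝ) * h.1 (x i)

/-- The usual measurability convention for a (possibly uncountable) class `F` of functions on a
measurable space: suprema over `F` of linear combinations of evaluations at finitely many points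
are measurable functions of these points. -/
def MeasurableClass [MeasurableSpace X] (F : Set (X → ℝ)) : Prop :=
  ∀ (k : ℕ) (a : Fin k → ℝ), Measurable fun x : Fin k → X => ⨆ h : F, ∑ i, a i * h.1 (x i)

end DomainAdaptation

end

open DomainAdaptation

/-!
The Rademacher complexity of `H` is not needed as an upper bound: it is nonnegative, and everything
follows from uniform deviations over the threshold class `H'` of `H`.

Deterministic part. By the layer-cake formula `v = ∫ t in 0..1, sgn (v - t)` for `v ∈ [0, 1]`, the
mean of `|h - f|` on a sample is an average of means of members of `H'`. So passing from the mean
on the source sample to the mean on the target sample costs at most the divergence of the two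
empirical distributions (`empRisk_sub_empRisk_le_sampleGap`, `sampleGap_le_divergence`), and
passing from the target sample `y` to the target distribution costs at most `ghostGap DT H' y`,
the expected largest excess over `g ∈ H'` of the mean of `g` on a ghost sample over its mean on `y`
(`risk_sub_empRisk_le_ghostGap`). The labeling functions are exchanged by the triangle inequality
either under the target distribution (`risk_le_of_target`) or on the source sample
(`risk_le_of_source`). The smaller of the two terms of the minimum is not random, so one of the two
ways is chosen in advance. Only the second way leaves a further fluctuation, that of the mean of
`|fS - fT|` on the source sample.

Probabilistic part. By symmetrization `ghostGap DT H' y - 2 * rademacher H' y` has nonpositive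
expectation (`integral_ghostGap_le`), and it has bounded differences, so it is sub-Gaussian by
McDiarmid's inequality (`hasSubgaussianMGF_of_boundedDifferences`), as is the mean of `|fS - fT|`
after centering. A sum of two sub-Gaussian variables is sub-Gaussian without any independence, so a
single tail bound suffices. It is this absence of a union bound that gives `log (1 / δ)` without an
additive constant, hence a statement that stays meaningful as `δ` approaches `1`. Finally
`rademacher H' y` is at most twice the pooled complexity (`rademacher_le_two_mul_pooled`), which
gives both forms of the bound at once.

`MeasurableClass` concerns suprema of linear combinations of evaluations only, so it says nothing
about the measurability of the supremum of the deviations from the true means. Averaging over a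
ghost sample outside the supremum avoids this question.
-/

namespace DomainAdaptation

/-! ### McDiarmid's inequality -/

theorem integrable_of_abs_le {α : Type*} [MeasurableSpace α] {μ : Measure α} [IsFiniteMeasure μ]
    {f : α → ℝ} (hf : Measurable f) {B : ℝ} (hB : ∀ x, |f x| ≤ B) : Integrable f μ :=
  Integrable.of_bound hf.aestronglyMeasurable B (ae_of_all _ fun x => hB x)

theorem abs_integral_le_of_abs_le {α : Type*} [MeasurableSpace α] {μ : Measure α}
    [IsProbabilityMeasure μ] {f : α → ℝ} {B : ℝ} (hB : ∀ x, |f x| ≤ B) : |∫ x, f x ∂μ| ≤ B := by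
  simpa using norm_integral_le_of_norm_le_const (μ := μ) (f := f) (ae_of_all _ fun x => hB x)

/-- Hoeffding's lemma, with the range of the variable controlled by its oscillation. -/
theorem hasSubgaussianMGF_of_oscillation_le {α : Type*} [MeasurableSpace α] {μ : Measure α}
    [IsProbabilityMeasure μ] {f : α → ℝ} (hf : Measurable f) {c : NNReal}
    (hc : ∀ x y, |f x - f y| ≤ c) :
    HasSubgaussianMGF (fun x => f x - ∫ y, f y ∂μ) (c ^ 2) μ := by
  obtain ⟨x₀⟩ := μ.nonempty_of_neZero
  have h := hasSubgaussianMGF_of_mem_Icc (μ := μ) (a := f x₀ - c) (b := f x₀ + c) hf.aemeasurable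
    (ae_of_all _ fun x => by
      have := abs_le.1 (hc x x₀)
      constructor <;> linarith)
  have e : (‖f x₀ + c - (f x₀ - c)‖₊ / 2) ^ 2 = c ^ 2 := by
    congr 1
    apply NNReal.eq
    have h2 : f x₀ + c - (f x₀ - c) = 2 * (c : ℝ) := by ring
    simp [h2]
  rwa [e] at h

/-- McDiarmid's inequality at the level of moment generating functions: a function of `n`
independent variables that moves by at most `c` when one variable changes is sub-Gaussian with
variance proxy `n * c ^ 2`. Conditionally on the other variables, Hoeffding's lemma bounds the
contribution of the first one, and the average over the first variable again has bounded
differences. -/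
theorem hasSubgaussianMGF_of_boundedDifferences {X : Type*} [MeasurableSpace X] (μ : Measure X)
    [IsProbabilityMeasure μ] (c : NNReal) {B : ℝ} (n : ℕ) (f : (Fin n → X) → ℝ)
    (hf : Measurable f) (hB : ∀ x, |f x| ≤ B)
    (hc : ∀ x i y, |f (Function.update x i y) - f x| ≤ c) :
    HasSubgaussianMGF (fun x => f x - ∫ y, f y ∂Measure.pi fun _ => μ) (n * c ^ 2)
      (Measure.pi fun _ => μ) := by
  induction n with
  | zero =>
    have h : (fun x => f x - ∫ y, f y ∂Measure.pi fun _ : Fin 0 => μ) = fun _ => 0 := by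
      funext x
      have : f = fun _ => f x := by funext y; rw [Subsingleton.elim y x]
      rw [this]; simp
    rw [h]
    simp
  | succ n ih =>
    set π : Measure (Fin n → X) := Measure.pi fun _ => μ with hπ
    have hmp : MeasurePreserving (fun p : X × (Fin n → X) => (Fin.cons p.1 p.2 : Fin (n + 1) → X))
        (μ.prod π) (Measure.pi fun _ => μ) := by
      convert (measurePreserving_piFinSuccAbove (fun _ : Fin (n + 1) => μ) 0).symm using 1
      funext p
      exact (Fin.insertNth_zero' p.1 p.2).symm
    have hF : Measurable fun p : X × (Fin n → X) => f (Fin.cons p.1 p.2) := hf.comp hmp.measurable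
    set g : (Fin n → X) → ℝ := fun r => ∫ x, f (Fin.cons x r) ∂μ with hg
    have hFr (r : Fin n → X) : Measurable fun x => f (Fin.cons x r) :=
      hF.comp (measurable_id.prodMk measurable_const)
    have hgm : Measurable g :=
      (hF.stronglyMeasurable.integral_prod_left' (μ := μ)).measurable
    have hgB (r) : |g r| ≤ B := abs_integral_le_of_abs_le fun x => hB _
    have hgc (r : Fin n → X) (i y) : |g (Function.update r i y) - g r| ≤ c := by
      rw [hg, ← integral_sub (integrable_of_abs_le (hFr _) fun x => hB _)
        (integrable_of_abs_le (hFr _) fun x => hB _)]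
      refine abs_integral_le_of_abs_le fun x => ?_
      rw [Fin.cons_update]
      exact hc _ _ _
    have ih' := ih g hgm hgB hgc
    have hint : ∫ x, f x ∂(Measure.pi fun _ => μ) = ∫ r, g r ∂π := by
      rw [← hmp.map_eq, integral_map hmp.measurable.aemeasurable hf.aestronglyMeasurable,
        integral_prod_symm _ (integrable_of_abs_le hF fun p => hB _)]
    have hcond (r : Fin n → X) :
        HasSubgaussianMGF (fun x => f (Fin.cons x r) - g r) (c ^ 2) μ := by
      refine hasSubgaussianMGF_of_oscillation_le (hFr r) fun x y => ?_
      have := hc (Fin.cons y r) 0 x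
      rwa [Fin.update_cons_zero] at this
    set m : ℝ := ∫ r, g r ∂π with hm
    rw [hint]
    have hmB : |m| ≤ B := abs_integral_le_of_abs_le hgB
    have hbound (t : ℝ) {a : ℝ} (ha : |a| ≤ B) : |Real.exp (t * (a - m))| ≤
        Real.exp (|t| * (B + B)) := by
      rw [Real.abs_exp]
      apply Real.exp_le_exp.2
      calc t * (a - m) ≤ |t| * |a - m| := by rw [← abs_mul]; exact le_abs_self _
        _ ≤ |t| * (B + B) := by
          gcongr
          exact (abs_sub _ _).trans (add_le_add ha hmB)
    have hexp (t : ℝ) : Measurable fun x => Real.exp (t * (f x - m)) := by fun_prop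
    refine ⟨fun t => integrable_of_abs_le (hexp t) fun x => hbound t (hB x), fun t => ?_⟩
    have hexpF : Measurable fun p : X × (Fin n → X) =>
        Real.exp (t * (f (Fin.cons p.1 p.2) - m)) := (hexp t).comp hmp.measurable
    have hintF := integrable_of_abs_le (μ := μ.prod π) hexpF fun p => hbound t (hB _)
    calc mgf (fun x => f x - m) (Measure.pi fun _ => μ) t
        = ∫ r, ∫ x, Real.exp (t * (f (Fin.cons x r) - m)) ∂μ ∂π := by
          rw [mgf, ← hmp.map_eq, integral_map hmp.measurable.aemeasurable
            (hexp t).aestronglyMeasurable, integral_prod_symm _ hintF]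
      _ ≤ ∫ r, Real.exp ((c ^ 2 : NNReal) * t ^ 2 / 2) * Real.exp (t * (g r - m)) ∂π := by
          refine integral_mono hintF.integral_prod_right
            ((ih'.integrable_exp_mul t).const_mul _) fun r => ?_
          have h1 : ∀ x, Real.exp (t * (f (Fin.cons x r) - m)) =
              Real.exp (t * (f (Fin.cons x r) - g r)) * Real.exp (t * (g r - m)) := fun x => by
            rw [← Real.exp_add]; ring_nf
          simp only [h1, integral_mul_const]
          gcongr
          exact (hcond r).mgf_le t
      _ ≤ Real.exp ((c ^ 2 : NNReal) * t ^ 2 / 2) *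
            Real.exp ((n * c ^ 2 : NNReal) * t ^ 2 / 2) := by
          rw [integral_const_mul]
          gcongr
          exact ih'.mgf_le t
      _ = Real.exp (((n + 1 : ℕ) * c ^ 2 : NNReal) * t ^ 2 / 2) := by
          rw [← Real.exp_add]
          push_cast
          ring_nf

/-! ### Suprema and averages -/

theorem bddAbove_range_of_abs_le {ι : Type*} {a : ι → ℝ} {B : ℝ} (h : ∀ i, |a i| ≤ B) :
    BddAbove (Set.range a) :=
  ⟨B, by rintro _ ⟨i, rfl⟩; exact (le_abs_self _).trans (h i)⟩

theorem abs_ciSup_le {ι : Type*} [Nonempty ι] {a : ι → ℝ} {B : ℝ} (h : ∀ i, |a i| ≤ B) :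
    |⨆ i, a i| ≤ B := by
  obtain ⟨i⟩ := ‹Nonempty ι›
  exact abs_le.2 ⟨(abs_le.1 (h i)).1.trans (le_ciSup (bddAbove_range_of_abs_le h) i),
    ciSup_le fun j => (le_abs_self _).trans (h j)⟩

theorem abs_ciSup_sub_ciSup_le {ι : Type*} [Nonempty ι] {a b : ι → ℝ} {c : ℝ}
    (ha : BddAbove (Set.range a)) (hb : BddAbove (Set.range b)) (h : ∀ i, |a i - b i| ≤ c) :
    |(⨆ i, a i) - ⨆ i, b i| ≤ c := by
  rw [abs_sub_le_iff]
  constructor <;> rw [sub_le_iff_le_add] <;> refine ciSup_le fun i => ?_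
  · linarith [(abs_le.1 (h i)).2, le_ciSup hb i]
  · linarith [(abs_le.1 (h i)).1, le_ciSup ha i]

theorem abs_mean_le {ι : Type*} [Fintype ι] {v : ι → ℝ} {B : ℝ} (hB : 0 ≤ B)
    (h : ∀ i, |v i| ≤ B) : |(1 / (Fintype.card ι : ℝ)) * ∑ i, v i| ≤ B := by
  rw [abs_mul, abs_of_nonneg (by positivity : (0 : ℝ) ≤ 1 / (Fintype.card ι : ℝ))]
  have h1 : |∑ i, v i| ≤ Fintype.card ι * B := by
    refine (Finset.abs_sum_le_sum_abs _ _).trans ((Finset.sum_le_sum fun i _ => h i).trans_eq ?_)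
    simp
  rcases Nat.eq_zero_or_pos (Fintype.card ι) with h0 | h0
  · simpa [h0] using hB
  · have : (0 : ℝ) < Fintype.card ι := by exact_mod_cast h0
    rw [one_div, inv_mul_le_iff₀ this]
    exact h1

theorem abs_mean_sub_mean_le {ι : Type*} [Fintype ι] {u v : ι → ℝ} {B : ℝ} (hB : 0 ≤ B)
    (h : ∀ i, |u i - v i| ≤ B) :
    |(1 / (Fintype.card ι : ℝ)) * ∑ i, u i - (1 / (Fintype.card ι : ℝ)) * ∑ i, v i| ≤ B := by
  rw [← mul_sub, ← Finset.sum_sub_distrib]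
  exact abs_mean_le hB h

/-- The average of `n` numbers moves by at most `1 / n` when one of them changes by at most `1`. -/
theorem abs_mean_sub_mean_le_of_eq_off {n : ℕ} {u v : Fin n → ℝ} (i : Fin n)
    (h : ∀ j ≠ i, u j = v j) (hi : |u i - v i| ≤ 1) :
    |(1 / (n : ℝ)) * ∑ j, u j - (1 / (n : ℝ)) * ∑ j, v j| ≤ 1 / n := by
  rw [← mul_sub, ← Finset.sum_sub_distrib,
    Finset.sum_eq_single i (fun j _ hj => by rw [h j hj, sub_self]) (by simp), abs_mul,
    abs_of_nonneg (by positivity : (0 : ℝ) ≤ 1 / (n : ℝ))]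
  exact mul_le_of_le_one_right (by positivity) hi

theorem abs_sub_le_one_of_mem_Icc {a b : ℝ} (ha : a ∈ Set.Icc (0 : ℝ) 1)
    (hb : b ∈ Set.Icc (0 : ℝ) 1) : |a - b| ≤ 1 :=
  abs_le.2 ⟨by linarith [ha.1, hb.2], by linarith [ha.2, hb.1]⟩

theorem abs_unit_cast (s : ℤˣ) : |((s : ℤ) : ℝ)| = 1 := by
  rcases Int.units_eq_one_or s with h | h <;> simp [h]

theorem abs_unit_mul_le_one (s : ℤˣ) {a : ℝ} (ha : a ∈ Set.Icc (0 : ℝ) 1) :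
    |((s : ℤ) : ℝ) * a| ≤ 1 := by
  rw [abs_mul, abs_unit_cast, one_mul]
  exact abs_le.2 ⟨by linarith [ha.1], ha.2⟩

/-! ### Empirical Rademacher complexities -/

variable {X : Type*}

/-- The supremum over the class `F` of the correlations of its members with a fixed sign vector
on the sample `x`; `rademacher F x` is its average over all sign vectors. -/
noncomputable def radSup {ι : Type*} [Fintype ι] (F : Set (X → ℝ)) (x : ι → X) (σ : ι → ℤˣ) : ℝ :=
  ⨆ h : F, (1 / (Fintype.card ι : ℝ)) * ∑ i, ((σ i : ℤ) : ℝ) * h.1 (x i)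

theorem rademacher_eq {ι : Type*} [Fintype ι] [DecidableEq ι] (F : Set (X → ℝ)) (x : ι → X) :
    rademacher F x = (1 / (Fintype.card (ι → ℤˣ) : ℝ)) * ∑ σ : ι → ℤˣ, radSup F x σ := rfl

section

variable {F : Set (X → ℝ)} (hF : ∀ h ∈ F, ∀ x, h x ∈ Set.Icc (0 : ℝ) 1)
include hF

theorem abs_correlation_le {ι : Type*} [Fintype ι] (x : ι → X) (σ : ι → ℤˣ) (h : F) :
    |(1 / (Fintype.card ι : ℝ)) * ∑ i, ((σ i : ℤ) : ℝ) * h.1 (x i)| ≤ 1 :=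
  abs_mean_le zero_le_one fun _ => abs_unit_mul_le_one _ (hF h.1 h.2 _)

theorem bddAbove_correlation {ι : Type*} [Fintype ι] (x : ι → X) (σ : ι → ℤˣ) :
    BddAbove (Set.range fun h : F =>
      (1 / (Fintype.card ι : ℝ)) * ∑ i, ((σ i : ℤ) : ℝ) * h.1 (x i)) :=
  bddAbove_range_of_abs_le (abs_correlation_le hF x σ)

theorem correlation_le_radSup {ι : Type*} [Fintype ι] (x : ι → X) (σ : ι → ℤˣ) (h : F) :
    (1 / (Fintype.card ι : ℝ)) * ∑ i, ((σ i : ℤ) : ℝ) * h.1 (x i) ≤ radSup F x σ :=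
  le_ciSup (bddAbove_correlation hF x σ) h

theorem abs_radSup_le [Nonempty F] {ι : Type*} [Fintype ι] (x : ι → X) (σ : ι → ℤˣ) :
    |radSup F x σ| ≤ 1 :=
  abs_ciSup_le (abs_correlation_le hF x σ)

theorem abs_rademacher_le [Nonempty F] {ι : Type*} [Fintype ι] [DecidableEq ι] (x : ι → X) :
    |rademacher F x| ≤ 1 :=
  abs_mean_le zero_le_one fun σ => abs_radSup_le hF x σ

theorem rademacher_nonneg [Nonempty F] {ι : Type*} [Fintype ι] [DecidableEq ι] (x : ι → X) :
    0 ≤ rademacher F x := by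
  obtain ⟨h⟩ := ‹Nonempty F›
  -- opposite sign vectors give opposite correlations of any fixed `h` with the signs
  have hpair (σ : ι → ℤˣ) : 0 ≤ radSup F x σ + radSup F x (-σ) := by
    have h1 := correlation_le_radSup hF x σ h
    have h2 := correlation_le_radSup hF x (-σ) h
    simp only [Pi.neg_apply, Units.val_neg, Int.cast_neg, neg_mul, Finset.sum_neg_distrib,
      mul_neg] at h2
    linarith
  have hsum : ∑ σ : ι → ℤˣ, radSup F x (-σ) = ∑ σ : ι → ℤˣ, radSup F x σ :=
    Equiv.sum_comp (Equiv.neg (ι → ℤˣ)) (radSup F x)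
  have := Finset.sum_nonneg fun σ (_ : σ ∈ Finset.univ) => hpair σ
  rw [Finset.sum_add_distrib, hsum] at this
  rw [rademacher_eq]
  have h0 : 0 ≤ ∑ σ : ι → ℤˣ, radSup F x σ := by linarith
  positivity

/-- Averaging over the signs on the first half of a pooled sample can only decrease the supremum,
so the pooled complexity is at least half of that of the second half. -/
theorem rademacher_le_two_mul_pooled [Nonempty F] {n : ℕ} (x y : Fin n → X) :
    rademacher F y ≤ 2 * rademacher F (Sum.elim x y) := by
  have hle (σ τ : Fin n → ℤˣ) : radSup F y τ ≤
      radSup F (Sum.elim x y) (Sum.elim σ τ) + radSup F (Sum.elim x y) (Sum.elim (-σ) τ) := by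
    refine ciSup_le fun h => ?_
    have h1 := correlation_le_radSup hF (Sum.elim x y) (Sum.elim σ τ) h
    have h2 := correlation_le_radSup hF (Sum.elim x y) (Sum.elim (-σ) τ) h
    simp only [Fintype.sum_sum_type, Sum.elim_inl, Sum.elim_inr, Fintype.card_sum, Nat.cast_add,
      Pi.neg_apply, Units.val_neg, Int.cast_neg, neg_mul, Finset.sum_neg_distrib,
      Fintype.card_fin, one_div] at h1 h2 ⊢
    rw [← two_mul, mul_inv] at h1 h2
    linarith
  have hneg : ∑ σ : Fin n → ℤˣ, ∑ τ : Fin n → ℤˣ,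
        radSup F (Sum.elim x y) (Sum.elim (-σ) τ) =
      ∑ σ : Fin n → ℤˣ, ∑ τ : Fin n → ℤˣ, radSup F (Sum.elim x y) (Sum.elim σ τ) :=
    Equiv.sum_comp (Equiv.neg (Fin n → ℤˣ))
      fun σ => ∑ τ : Fin n → ℤˣ, radSup F (Sum.elim x y) (Sum.elim σ τ)
  have hpool : ∑ σ : Fin n ⊕ Fin n → ℤˣ, radSup F (Sum.elim x y) σ =
      ∑ σ : Fin n → ℤˣ, ∑ τ : Fin n → ℤˣ, radSup F (Sum.elim x y) (Sum.elim σ τ) := by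
    rw [← (Equiv.sumArrowEquivProdArrow (Fin n) (Fin n) ℤˣ).symm.sum_comp,
      Fintype.sum_prod_type]
    rfl
  have hsum := Finset.sum_le_sum fun σ (_ : σ ∈ (Finset.univ : Finset (Fin n → ℤˣ))) =>
    Finset.sum_le_sum fun τ (_ : τ ∈ (Finset.univ : Finset (Fin n → ℤˣ))) => hle σ τ
  simp only [Finset.sum_add_distrib] at hsum
  rw [hneg, ← hpool, Finset.sum_const, nsmul_eq_mul, Finset.card_univ, ← two_mul] at hsum
  have hcard : (Fintype.card (Fin n ⊕ Fin n → ℤˣ) : ℝ) =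
      Fintype.card (Fin n → ℤˣ) * Fintype.card (Fin n → ℤˣ) := by
    rw [← Nat.cast_mul, ← Fintype.card_prod,
      Fintype.card_congr (Equiv.sumArrowEquivProdArrow (Fin n) (Fin n) ℤˣ)]
  have hpos : (0 : ℝ) < Fintype.card (Fin n → ℤˣ) := by exact_mod_cast Fintype.card_pos
  rw [rademacher_eq, rademacher_eq, hcard]
  calc (1 / (Fintype.card (Fin n → ℤˣ) : ℝ)) * ∑ τ, radSup F y τ
      = 1 / (Fintype.card (Fin n → ℤˣ) * Fintype.card (Fin n → ℤˣ) : ℝ) *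
          (Fintype.card (Fin n → ℤˣ) * ∑ τ, radSup F y τ) := by field_simp
    _ ≤ 1 / (Fintype.card (Fin n → ℤˣ) * Fintype.card (Fin n → ℤˣ) : ℝ) *
          (2 * ∑ σ : Fin n ⊕ Fin n → ℤˣ, radSup F (Sum.elim x y) σ) := by gcongr
    _ = _ := by ring

theorem abs_rademacher_update_sub_le [Nonempty F] {n : ℕ} (x : Fin n → X) (i : Fin n) (y : X) :
    |rademacher F (Function.update x i y) - rademacher F x| ≤ 1 / n := by
  refine abs_mean_sub_mean_le (by positivity) fun σ => ?_
  refine abs_ciSup_sub_ciSup_le (bddAbove_correlation hF _ _) (bddAbove_correlation hF _ _)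
    fun h => ?_
  rw [Fintype.card_fin]
  refine abs_mean_sub_mean_le_of_eq_off i (fun j hj => by rw [Function.update_of_ne hj]) ?_
  rw [← mul_sub, abs_mul, abs_unit_cast, one_mul]
  exact abs_sub_le_one_of_mem_Icc (hF _ h.2 _) (hF _ h.2 _)

end

/-! ### Symmetrization -/

/-- The supremum over `h ∈ F` of the amount by which the mean of `h` on the sample `x` exceeds its
mean on the sample `y`. -/
noncomputable def sampleGap {n : ℕ} (F : Set (X → ℝ)) (x y : Fin n → X) : ℝ :=
  ⨆ h : F, ((1 / (n : ℝ)) * ∑ i, h.1 (x i) - (1 / (n : ℝ)) * ∑ i, h.1 (y i))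

/-- The mean of `sampleGap F x y` over an independent ghost sample `x` from `D`. It dominates
the supremum over `h ∈ F` of the difference between the mean of `h` under `D` and on `y`, and it
is measurable in `y` for every `MeasurableClass`. -/
noncomputable def ghostGap [MeasurableSpace X] (D : Measure X) {n : ℕ} (F : Set (X → ℝ))
    (y : Fin n → X) : ℝ :=
  ∫ x, sampleGap F x y ∂Measure.pi fun _ : Fin n => D

/-- Exchange the `i`-th entries of two samples for all `i` with `σ i = -1`. -/
def swapSigns {n : ℕ} (σ : Fin n → ℤˣ) (p : (Fin n → X) × (Fin n → X)) :
    (Fin n → X) × (Fin n → X) :=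
  (fun i => if σ i = 1 then p.1 i else p.2 i, fun i => if σ i = 1 then p.2 i else p.1 i)

theorem measurePreserving_swapSigns [MeasurableSpace X] (D : Measure X) [IsProbabilityMeasure D]
    {n : ℕ} (σ : Fin n → ℤˣ) :
    MeasurePreserving (swapSigns (X := X) σ)
      ((Measure.pi fun _ : Fin n => D).prod (Measure.pi fun _ : Fin n => D))
      ((Measure.pi fun _ : Fin n => D).prod (Measure.pi fun _ : Fin n => D)) := by
  have he := measurePreserving_arrowProdEquivProdArrow X X (Fin n) (fun _ => D) (fun _ => D)
  have hs : MeasurePreserving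
      (fun (q : Fin n → X × X) i => (if σ i = 1 then id else Prod.swap : X × X → X × X) (q i))
      (Measure.pi fun _ => D.prod D) (Measure.pi fun _ => D.prod D) := by
    refine measurePreserving_pi (fun _ => D.prod D) (fun _ => D.prod D)
      (f := fun i => if σ i = 1 then id else Prod.swap) fun i => ?_
    split_ifs
    · exact MeasurePreserving.id _
    · exact Measure.measurePreserving_swap
  convert he.comp (hs.comp he.symm) using 1
  funext p
  refine Prod.ext ?_ ?_ <;> funext i <;> by_cases h : σ i = 1 <;>
    simp [swapSigns, h, MeasurableEquiv.arrowProdEquivProdArrow, Equiv.arrowProdEquivProdArrow]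

theorem MeasurableClass.measurable_iSup [MeasurableSpace X] {F : Set (X → ℝ)}
    (hM : MeasurableClass F) {ι : Type*} [Fintype ι] (a : ι → ℝ) :
    Measurable fun x : ι → X => ⨆ h : F, ∑ i, a i * h.1 (x i) := by
  let e := Fintype.equivFin ι
  have hm : Measurable fun (x : ι → X) k => x (e.symm k) :=
    measurable_pi_lambda _ fun k => measurable_pi_apply _
  convert (hM _ (a ∘ e.symm)).comp hm using 1
  funext x
  refine iSup_congr fun h => ?_
  exact (e.symm.sum_comp fun i => a i * h.1 (x i)).symm

theorem MeasurableClass.measurable_radSup [MeasurableSpace X] {F : Set (X → ℝ)}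
    (hM : MeasurableClass F) {ι : Type*} [Fintype ι] (σ : ι → ℤˣ) :
    Measurable fun x : ι → X => radSup F x σ := by
  unfold radSup
  convert hM.measurable_iSup fun i => (1 / (Fintype.card ι : ℝ)) * ((σ i : ℤ) : ℝ) using 4
  rw [Finset.mul_sum]
  simp only [mul_assoc]

theorem MeasurableClass.measurable_rademacher [MeasurableSpace X] {F : Set (X → ℝ)}
    (hM : MeasurableClass F) {ι : Type*} [Fintype ι] [DecidableEq ι] :
    Measurable fun x : ι → X => rademacher F x :=
  (Finset.measurable_fun_sum _ fun σ _ => hM.measurable_radSup σ).const_mul _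

theorem MeasurableClass.measurable_sampleGap [MeasurableSpace X] {F : Set (X → ℝ)}
    (hM : MeasurableClass F) {n : ℕ} :
    Measurable fun p : (Fin n → X) × (Fin n → X) => sampleGap F p.1 p.2 := by
  have hm : Measurable fun p : (Fin n → X) × (Fin n → X) =>
      (Sum.elim p.1 p.2 : Fin n ⊕ Fin n → X) := by
    refine measurable_pi_lambda _ fun i => ?_
    rcases i with i | i
    · exact (measurable_pi_apply i).comp measurable_fst
    · exact (measurable_pi_apply i).comp measurable_snd
  convert (hM.measurable_iSup (Sum.elim (fun _ : Fin n => 1 / (n : ℝ))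
    (fun _ : Fin n => -(1 / (n : ℝ))))).comp hm using 1
  funext p
  refine iSup_congr fun h => ?_
  simp [Fintype.sum_sum_type, Finset.mul_sum, sub_eq_add_neg]

theorem MeasurableClass.measurable_sampleGap_left [MeasurableSpace X] {F : Set (X → ℝ)}
    (hM : MeasurableClass F) {n : ℕ} (y : Fin n → X) : Measurable fun x => sampleGap F x y :=
  Measurable.of_uncurry_right (f := sampleGap F) hM.measurable_sampleGap

theorem MeasurableClass.measurable_ghostGap [MeasurableSpace X] {F : Set (X → ℝ)}
    (hM : MeasurableClass F) (D : Measure X) [IsProbabilityMeasure D] {n : ℕ} :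
    Measurable fun y : Fin n → X => ghostGap D F y :=
  (hM.measurable_sampleGap.stronglyMeasurable.integral_prod_left'
    (μ := Measure.pi fun _ : Fin n => D)).measurable

section

variable {F : Set (X → ℝ)} (hF : ∀ h ∈ F, ∀ x, h x ∈ Set.Icc (0 : ℝ) 1)
include hF

theorem abs_sampleGap_term_le {n : ℕ} (x y : Fin n → X) (h : F) :
    |(1 / (n : ℝ)) * ∑ i, h.1 (x i) - (1 / (n : ℝ)) * ∑ i, h.1 (y i)| ≤ 1 := by
  simpa only [Fintype.card_fin] using abs_mean_sub_mean_le zero_le_one fun i =>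
    abs_sub_le_one_of_mem_Icc (hF h.1 h.2 (x i)) (hF h.1 h.2 (y i))

theorem bddAbove_sampleGap_term {n : ℕ} (x y : Fin n → X) :
    BddAbove (Set.range fun h : F =>
      (1 / (n : ℝ)) * ∑ i, h.1 (x i) - (1 / (n : ℝ)) * ∑ i, h.1 (y i)) :=
  bddAbove_range_of_abs_le (abs_sampleGap_term_le hF x y)

theorem le_sampleGap {n : ℕ} (x y : Fin n → X) {h : X → ℝ} (hh : h ∈ F) :
    (1 / (n : ℝ)) * ∑ i, h (x i) - (1 / (n : ℝ)) * ∑ i, h (y i) ≤ sampleGap F x y :=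
  le_ciSup (bddAbove_sampleGap_term hF x y) ⟨h, hh⟩

theorem abs_sampleGap_le [Nonempty F] {n : ℕ} (x y : Fin n → X) : |sampleGap F x y| ≤ 1 :=
  abs_ciSup_le (abs_sampleGap_term_le hF x y)

theorem abs_sampleGap_update_sub_le [Nonempty F] {n : ℕ} (x y : Fin n → X) (i : Fin n) (z : X) :
    |sampleGap F x (Function.update y i z) - sampleGap F x y| ≤ 1 / n := by
  refine abs_ciSup_sub_ciSup_le (bddAbove_sampleGap_term hF _ _) (bddAbove_sampleGap_term hF _ _)
    fun h => ?_
  rw [sub_sub_sub_cancel_left, abs_sub_comm]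
  refine abs_mean_sub_mean_le_of_eq_off i (fun j hj => by rw [Function.update_of_ne hj]) ?_
  exact abs_sub_le_one_of_mem_Icc (hF _ h.2 _) (hF _ h.2 _)

/-- After exchanging entries according to the signs `σ`, the gap is a supremum of differences of
correlations with `σ`. -/
theorem sampleGap_swapSigns_le [Nonempty F] {n : ℕ} (σ : Fin n → ℤˣ)
    (p : (Fin n → X) × (Fin n → X)) :
    sampleGap F (swapSigns σ p).1 (swapSigns σ p).2 ≤ radSup F p.1 σ + radSup F p.2 (-σ) := by
  refine ciSup_le fun h => ?_
  have h1 := correlation_le_radSup hF p.1 σ h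
  have h2 := correlation_le_radSup hF p.2 (-σ) h
  refine le_trans (le_of_eq ?_) (add_le_add h1 h2)
  rw [Fintype.card_fin, ← mul_sub, ← mul_add, ← Finset.sum_sub_distrib, ← Finset.sum_add_distrib]
  congr 1
  refine Finset.sum_congr rfl fun i _ => ?_
  rcases Int.units_eq_one_or (σ i) with hσ | hσ <;> simp [swapSigns, hσ] <;> ring

variable [MeasurableSpace X] (hM : MeasurableClass F) (D : Measure X) [IsProbabilityMeasure D]

theorem abs_ghostGap_le [Nonempty F] {n : ℕ} (y : Fin n → X) : |ghostGap D F y| ≤ 1 :=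
  abs_integral_le_of_abs_le fun x => abs_sampleGap_le hF x y

include hM

theorem abs_ghostGap_update_sub_le [Nonempty F] {n : ℕ} (y : Fin n → X) (i : Fin n) (z : X) :
    |ghostGap D F (Function.update y i z) - ghostGap D F y| ≤ 1 / n := by
  rw [ghostGap, ghostGap, ← integral_sub
    (integrable_of_abs_le (hM.measurable_sampleGap_left _) fun x => abs_sampleGap_le hF x _)
    (integrable_of_abs_le (hM.measurable_sampleGap_left _) fun x => abs_sampleGap_le hF x _)]
  exact abs_integral_le_of_abs_le fun x => abs_sampleGap_update_sub_le hF x y i z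

/-- Symmetrization: the law of a pair of independent samples is invariant under every
`swapSigns σ`, and averaging `sampleGap_swapSigns_le` over `σ` gives two Rademacher complexities. -/
theorem integral_ghostGap_le [Nonempty F] {n : ℕ} :
    ∫ y, ghostGap D F y ∂(Measure.pi fun _ : Fin n => D) ≤
      2 * ∫ y, rademacher F y ∂(Measure.pi fun _ : Fin n => D) := by
  set π := Measure.pi fun _ : Fin n => D with hπ
  have hgap : Measurable fun p : (Fin n → X) × (Fin n → X) => sampleGap F p.1 p.2 :=
    hM.measurable_sampleGap
  have hint : Integrable (fun p : (Fin n → X) × (Fin n → X) => sampleGap F p.1 p.2) (π.prod π) :=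
    integrable_of_abs_le hgap fun p => abs_sampleGap_le hF p.1 p.2
  have hpair : ∫ y, ghostGap D F y ∂π = ∫ p, sampleGap F p.1 p.2 ∂(π.prod π) :=
    (integral_prod_symm _ hint).symm
  have hrad (σ : Fin n → ℤˣ) : Integrable (fun x => radSup F x σ) π :=
    integrable_of_abs_le (hM.measurable_radSup σ) fun x => abs_radSup_le hF x σ
  have hσ (σ : Fin n → ℤˣ) : ∫ y, ghostGap D F y ∂π ≤
      ∫ x, radSup F x σ ∂π + ∫ x, radSup F x (-σ) ∂π := by
    have hswap := measurePreserving_swapSigns D σ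
    rw [← hπ] at hswap
    have h1 : Integrable (fun p : (Fin n → X) × (Fin n → X) => radSup F p.1 σ) (π.prod π) :=
      (hrad σ).comp_fst π
    have h2 : Integrable (fun p : (Fin n → X) × (Fin n → X) => radSup F p.2 (-σ)) (π.prod π) :=
      (hrad (-σ)).comp_snd π
    calc ∫ y, ghostGap D F y ∂π
        = ∫ p, sampleGap F (swapSigns σ p).1 (swapSigns σ p).2 ∂(π.prod π) := by
          rw [hpair]
          conv_lhs => rw [← hswap.map_eq]
          rw [integral_map hswap.measurable.aemeasurable hgap.aestronglyMeasurable]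
      _ ≤ ∫ p, (radSup F p.1 σ + radSup F p.2 (-σ)) ∂(π.prod π) :=
          integral_mono (integrable_of_abs_le (hgap.comp hswap.measurable) fun p =>
            abs_sampleGap_le hF _ _) (h1.add h2) (sampleGap_swapSigns_le hF σ)
      _ = _ := by
          rw [integral_add h1 h2, integral_fun_fst (fun x => radSup F x σ),
            integral_fun_snd (fun x => radSup F x (-σ))]
          simp
  have hsum := Finset.sum_le_sum fun σ (_ : σ ∈ (Finset.univ : Finset (Fin n → ℤˣ))) => hσ σ
  have hneg : ∑ σ : Fin n → ℤˣ, ∫ x, radSup F x (-σ) ∂π =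
      ∑ σ : Fin n → ℤˣ, ∫ x, radSup F x σ ∂π :=
    Equiv.sum_comp (Equiv.neg (Fin n → ℤˣ)) fun σ => ∫ x, radSup F x σ ∂π
  rw [Finset.sum_const, nsmul_eq_mul, Finset.card_univ, Finset.sum_add_distrib, hneg,
    ← two_mul] at hsum
  have hpos : (0 : ℝ) < Fintype.card (Fin n → ℤˣ) := by exact_mod_cast Fintype.card_pos
  simp only [rademacher_eq]
  rw [integral_const_mul, integral_finsetSum _ fun σ _ => hrad σ, ← mul_assoc, mul_one_div,
    div_mul_eq_mul_div, le_div_iff₀' hpos]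
  exact hsum

/-- The excess of `ghostGap` over twice the Rademacher complexity is sub-Gaussian: it has bounded
differences `3 / n`. -/
theorem hasSubgaussianMGF_ghostGap_sub [Nonempty F] {n : ℕ} :
    HasSubgaussianMGF (fun y : Fin n → X => (ghostGap D F y - 2 * rademacher F y) -
        ∫ y, (ghostGap D F y - 2 * rademacher F y) ∂(Measure.pi fun _ : Fin n => D))
      (n * (3 / n) ^ 2) (Measure.pi fun _ : Fin n => D) := by
  refine hasSubgaussianMGF_of_boundedDifferences D (3 / n) (B := 3) n _
    ((hM.measurable_ghostGap D).sub (hM.measurable_rademacher.const_mul 2)) (fun y => ?_)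
    fun y i z => ?_
  · have h1 := abs_le.1 (abs_ghostGap_le hF D y)
    have h2 := abs_le.1 (abs_rademacher_le hF y)
    exact abs_le.2 ⟨by linarith [h1.1, h2.2], by linarith [h1.2, h2.1]⟩
  · have h1 := abs_le.1 (abs_ghostGap_update_sub_le hF hM D y i z)
    have h2 := abs_le.1 (abs_rademacher_update_sub_le hF y i z)
    have h3 : ((3 / n : NNReal) : ℝ) = 3 * (1 / n) := by push_cast; ring
    rw [h3]
    exact abs_le.2 ⟨by linarith [h1.1, h2.2], by linarith [h1.2, h2.1]⟩

theorem integral_ghostGap_sub_nonpos [Nonempty F] {n : ℕ} :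
    ∫ y, (ghostGap D F y - 2 * rademacher F y) ∂(Measure.pi fun _ : Fin n => D) ≤ 0 := by
  rw [integral_sub (integrable_of_abs_le (hM.measurable_ghostGap D) (abs_ghostGap_le hF D))
    ((integrable_of_abs_le hM.measurable_rademacher (abs_rademacher_le hF)).const_mul 2),
    integral_const_mul]
  linarith [integral_ghostGap_le hF hM D (n := n)]

end

/-! ### Threshold classes and mean absolute differences -/

theorem binSgn_mem_Icc (z : ℝ) : binSgn z ∈ Set.Icc (0 : ℝ) 1 := by
  unfold binSgn
  split_ifs <;> simp

theorem antitone_binSgn_sub (v : ℝ) : Antitone fun t => binSgn (v - t) := by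
  intro s t hst
  simp only [binSgn]
  split_ifs <;> linarith

theorem integral_binSgn_sub {v : ℝ} (hv : v ∈ Set.Icc (0 : ℝ) 1) :
    ∫ t in (0 : ℝ)..1, binSgn (v - t) = v := by
  have h : (fun t => binSgn (v - t)) = (Set.Iio v).indicator fun _ => (1 : ℝ) := by
    funext t
    simp [binSgn, Set.indicator_apply]
  have hI : Set.Ioc (0 : ℝ) 1 ∩ Set.Iio v = Set.Ioo 0 v := by
    ext t
    simp only [Set.mem_inter_iff, Set.mem_Ioc, Set.mem_Iio, Set.mem_Ioo]
    exact ⟨fun h => ⟨h.1.1, h.2⟩, fun h => ⟨⟨h.1, h.2.le.trans hv.2⟩, h.2⟩⟩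
  rw [h, intervalIntegral.integral_of_le zero_le_one, setIntegral_indicator measurableSet_Iio, hI]
  simp [hv.1]

theorem thresholdClass_mem_Icc {H : Set (X → ℝ)} {g : X → ℝ} (hg : g ∈ thresholdClass H) (x : X) :
    g x ∈ Set.Icc (0 : ℝ) 1 := by
  obtain ⟨h, -, h', -, t, -, rfl⟩ := hg
  exact binSgn_mem_Icc _

theorem measurable_binSgn : Measurable binSgn :=
  Measurable.ite measurableSet_Ioi measurable_const measurable_const

theorem measurable_of_mem_thresholdClass [MeasurableSpace X] {H : Set (X → ℝ)}
    (hH : ∀ h ∈ H, Measurable h) {g : X → ℝ} (hg : g ∈ thresholdClass H) : Measurable g := by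
  obtain ⟨h, hh, h', hh', t, -, rfl⟩ := hg
  have h1 := hH h hh
  have h2 := hH h' hh'
  exact measurable_binSgn.comp (by fun_prop)

theorem nonempty_thresholdClass {H : Set (X → ℝ)} {f : X → ℝ} (hf : f ∈ H) :
    Nonempty (thresholdClass H) :=
  ⟨⟨_, f, hf, f, hf, 0, ⟨le_rfl, zero_le_one⟩, rfl⟩⟩

/-- By the layer-cake formula a mean of `|h - f|` is an average over `t ∈ [0, 1]` of means of the
thresholds `x ↦ sgn (|h x - f x| - t)`, so its change between two samples is at most the largest
change of the mean of a member of the threshold class. -/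
theorem empRisk_sub_empRisk_le_sampleGap {H : Set (X → ℝ)}
    (hH : ∀ h ∈ H, ∀ x, h x ∈ Set.Icc (0 : ℝ) 1) {h f : X → ℝ} (hh : h ∈ H) (hf : f ∈ H) {n : ℕ}
    (x y : Fin n → X) :
    empRisk x h f - empRisk y h f ≤ sampleGap (thresholdClass H) x y := by
  have hint (a : ℝ) : IntervalIntegrable (fun t => binSgn (a - t)) volume 0 1 :=
    (antitone_binSgn_sub a).intervalIntegrable
  have hmem (z : X) : |h z - f z| ∈ Set.Icc (0 : ℝ) 1 :=
    ⟨abs_nonneg _, abs_sub_le_one_of_mem_Icc (hH h hh z) (hH f hf z)⟩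
  have hsumint (z : Fin n → X) : IntervalIntegrable
      (fun t => (1 / (n : ℝ)) * ∑ i, binSgn (|h (z i) - f (z i)| - t)) volume 0 1 := by
    have := IntervalIntegrable.sum Finset.univ fun i _ => hint |h (z i) - f (z i)|
    simpa only [Finset.sum_apply] using this.const_mul (1 / (n : ℝ))
  have hemp (z : Fin n → X) : empRisk z h f =
      ∫ t in (0 : ℝ)..1, (1 / (n : ℝ)) * ∑ i, binSgn (|h (z i) - f (z i)| - t) := by
    rw [intervalIntegral.integral_const_mul,
      intervalIntegral.integral_finsetSum fun i _ => hint _]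
    simp only [integral_binSgn_sub (hmem _), empRisk]
  rw [hemp x, hemp y, ← intervalIntegral.integral_sub (hsumint x) (hsumint y)]
  calc _ ≤ ∫ _ in (0 : ℝ)..1, sampleGap (thresholdClass H) x y := by
        refine intervalIntegral.integral_mono_on zero_le_one ((hsumint x).sub (hsumint y))
          intervalIntegrable_const fun t ht => ?_
        exact le_sampleGap (fun _ hg => thresholdClass_mem_Icc hg) x y ⟨h, hh, f, hf, t, ht, rfl⟩
    _ = _ := by simp

theorem empMeasure_real_preimage [MeasurableSpace X] {g : X → ℝ} (hg : Measurable g)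
    (hg01 : ∀ x, g x = 0 ∨ g x = 1) {n : ℕ} (x : Fin n → X) :
    (empMeasure x).real (g ⁻¹' {1}) = (1 / (n : ℝ)) * ∑ i, g (x i) := by
  have hA : MeasurableSet (g ⁻¹' {1}) := hg (measurableSet_singleton 1)
  have hterm (i : Fin n) : (Measure.dirac (x i) (g ⁻¹' {1})).toReal = g (x i) := by
    rw [Measure.dirac_apply' _ hA]
    rcases hg01 (x i) with h | h <;> simp [h]
  rw [Measure.real, empMeasure, Measure.smul_apply, smul_eq_mul, ENNReal.toReal_mul,
    Measure.finsetSum_apply, ENNReal.toReal_sum fun i _ => measure_ne_top _ _]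
  simp [hterm]

theorem sampleGap_le_divergence [MeasurableSpace X] {H : Set (X → ℝ)}
    (hH : ∀ h ∈ H, Measurable h) [Nonempty (thresholdClass H)] {n : ℕ} (x y : Fin n → X) :
    sampleGap (thresholdClass H) x y ≤ divergence (thresholdClass H) (empMeasure y)
      (empMeasure x) := by
  have hmean {g : X → ℝ} (hg : g ∈ thresholdClass H) (z : Fin n → X) :
      (empMeasure z).real (g ⁻¹' {1}) = (1 / (n : ℝ)) * ∑ i, g (z i) := by
    refine empMeasure_real_preimage (measurable_of_mem_thresholdClass hH hg) (fun w => ?_) z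
    obtain ⟨h, -, h', -, t, -, rfl⟩ := hg
    simp only [binSgn]
    split_ifs <;> simp
  have hbdd : BddAbove (Set.range fun A : supports (thresholdClass H) =>
      |(empMeasure y).real A - (empMeasure x).real A|) := by
    refine ⟨1, ?_⟩
    rintro _ ⟨⟨_, g, hg, rfl⟩, rfl⟩
    simp only [hmean hg]
    exact abs_sampleGap_term_le (fun _ hg => thresholdClass_mem_Icc hg) y x ⟨g, hg⟩
  refine ciSup_le fun g => ?_
  refine le_trans ?_ (le_ciSup hbdd ⟨_, g.1, g.2, rfl⟩)
  simp only [hmean g.2]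
  rw [abs_sub_comm]
  exact le_abs_self _

theorem integral_empRisk [MeasurableSpace X] (D : Measure X) [IsProbabilityMeasure D]
    {h f : X → ℝ} (hi : Integrable (fun x => |h x - f x|) D) {n : ℕ} (hn : n ≠ 0) :
    ∫ x, empRisk x h f ∂(Measure.pi fun _ : Fin n => D) = risk D h f := by
  have hn' : (n : ℝ) ≠ 0 := by exact_mod_cast hn
  have hcomp (i : Fin n) : Integrable (fun x : Fin n → X => |h (x i) - f (x i)|)
      (Measure.pi fun _ : Fin n => D) := integrable_comp_eval (μ := fun _ : Fin n => D) hi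
  unfold empRisk
  rw [integral_const_mul, integral_finsetSum _ fun i _ => hcomp i]
  simp_rw [integral_comp_eval (μ := fun _ : Fin n => D) (f := fun x => |h x - f x|)
    hi.aestronglyMeasurable]
  simp [risk, hn']

theorem empRisk_triangle {n : ℕ} (x : Fin n → X) (h f f' : X → ℝ) :
    empRisk x h f ≤ empRisk x h f' + empRisk x f' f := by
  unfold empRisk
  rw [← mul_add, ← Finset.sum_add_distrib]
  gcongr
  exact abs_sub_le _ _ _

theorem abs_empRisk_le {h f : X → ℝ} (hh : ∀ x, h x ∈ Set.Icc (0 : ℝ) 1)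
    (hf : ∀ x, f x ∈ Set.Icc (0 : ℝ) 1) {n : ℕ} (x : Fin n → X) : |empRisk x h f| ≤ 1 := by
  simpa only [Fintype.card_fin, empRisk] using abs_mean_le zero_le_one fun i =>
    (abs_abs (h (x i) - f (x i))).trans_le (abs_sub_le_one_of_mem_Icc (hh (x i)) (hf (x i)))

theorem measurable_empRisk [MeasurableSpace X] {h f : X → ℝ} (hh : Measurable h)
    (hf : Measurable f) {n : ℕ} : Measurable fun x : Fin n → X => empRisk x h f := by
  unfold empRisk
  refine (Finset.measurable_fun_sum _ fun i _ => ?_).const_mul _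
  exact (show Measurable fun x => |h x - f x| by fun_prop).comp (measurable_pi_apply i)

theorem hasSubgaussianMGF_empRisk_sub [MeasurableSpace X] (D : Measure X) [IsProbabilityMeasure D]
    {h f : X → ℝ} (hh : Measurable h) (hf : Measurable f) (hh01 : ∀ x, h x ∈ Set.Icc (0 : ℝ) 1)
    (hf01 : ∀ x, f x ∈ Set.Icc (0 : ℝ) 1) {n : ℕ} (hn : n ≠ 0) :
    HasSubgaussianMGF (fun x : Fin n → X => empRisk x h f - risk D h f) (n * (1 / n) ^ 2)
      (Measure.pi fun _ : Fin n => D) := by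
  have hi : Integrable (fun x => |h x - f x|) D :=
    integrable_of_abs_le (by fun_prop) fun x =>
      (abs_abs _).trans_le (abs_sub_le_one_of_mem_Icc (hh01 x) (hf01 x))
  rw [← integral_empRisk D hi hn]
  refine hasSubgaussianMGF_of_boundedDifferences D (1 / n) n _ (measurable_empRisk hh hf)
    (abs_empRisk_le hh01 hf01) fun x i y => ?_
  push_cast
  refine abs_mean_sub_mean_le_of_eq_off i (fun j hj => by rw [Function.update_of_ne hj]) ?_
  exact abs_sub_le_one_of_mem_Icc
    ⟨abs_nonneg _, abs_sub_le_one_of_mem_Icc (hh01 _) (hf01 _)⟩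
    ⟨abs_nonneg _, abs_sub_le_one_of_mem_Icc (hh01 _) (hf01 _)⟩

section

variable [MeasurableSpace X] {H : Set (X → ℝ)} (hH : ∀ h ∈ H, ∀ x, h x ∈ Set.Icc (0 : ℝ) 1)
  (hm : ∀ h ∈ H, Measurable h) (hM : MeasurableClass (thresholdClass H))
  (D : Measure X) [IsProbabilityMeasure D] {n : ℕ}
include hH hm hM

/-- The gap to a ghost sample controls the deviation of every true risk from its empirical
counterpart. -/
theorem risk_sub_empRisk_le_ghostGap {h f : X → ℝ} (hh : h ∈ H) (hf : f ∈ H) (hn : n ≠ 0)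
    (y : Fin n → X) : risk D h f - empRisk y h f ≤ ghostGap D (thresholdClass H) y := by
  have := nonempty_thresholdClass hf
  have h1 := hm h hh
  have h2 := hm f hf
  have hi : Integrable (fun x => |h x - f x|) D :=
    integrable_of_abs_le (by fun_prop) fun x =>
      (abs_abs _).trans_le (abs_sub_le_one_of_mem_Icc (hH h hh x) (hH f hf x))
  have hemp : Integrable (fun x : Fin n → X => empRisk x h f) (Measure.pi fun _ => D) :=
    integrable_of_abs_le (measurable_empRisk h1 h2) (abs_empRisk_le (hH h hh) (hH f hf))
  rw [← integral_empRisk D hi hn]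
  calc ∫ x, empRisk x h f ∂(Measure.pi fun _ : Fin n => D) - empRisk y h f
      = ∫ x, (empRisk x h f - empRisk y h f) ∂(Measure.pi fun _ : Fin n => D) := by
        rw [integral_sub hemp (integrable_const _)]
        simp
    _ ≤ _ := integral_mono (hemp.sub (integrable_const _))
        (integrable_of_abs_le (hM.measurable_sampleGap_left y)
          fun x => abs_sampleGap_le (fun _ hg => thresholdClass_mem_Icc hg) x y)
        fun x => empRisk_sub_empRisk_le_sampleGap hH hh hf x y

/-- Transfer of the target risk to the source sample with the labeling functions compared under
the target distribution. -/
theorem risk_le_of_target {h f f' : X → ℝ} (hh : h ∈ H) (hf : f ∈ H) (hf' : f' ∈ H) (hn : n ≠ 0)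
    (x y : Fin n → X) :
    risk D h f' ≤ empRisk x h f + divergence (thresholdClass H) (empMeasure x) (empMeasure y) +
      ghostGap D (thresholdClass H) y + risk D f f' := by
  have := nonempty_thresholdClass hf
  have hi {a b : X → ℝ} (ha : a ∈ H) (hb : b ∈ H) : Integrable (fun x => |a x - b x|) D :=
    integrable_of_abs_le ((hm a ha).sub (hm b hb)).abs fun x =>
      (abs_abs _).trans_le (abs_sub_le_one_of_mem_Icc (hH a ha x) (hH b hb x))
  have htri : risk D h f' ≤ risk D h f + risk D f f' := by
    unfold risk
    rw [← integral_add (hi hh hf) (hi hf hf')]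
    exact integral_mono (hi hh hf') ((hi hh hf).add (hi hf hf')) fun x => abs_sub_le _ _ _
  linarith [risk_sub_empRisk_le_ghostGap hH hm hM D hh hf hn y,
    empRisk_sub_empRisk_le_sampleGap hH hh hf y x, sampleGap_le_divergence hm y x]

/-- Transfer of the target risk to the source sample with the labeling functions compared on the
source sample. -/
theorem risk_le_of_source {h f f' : X → ℝ} (hh : h ∈ H) (hf' : f' ∈ H) (hn : n ≠ 0)
    (x y : Fin n → X) :
    risk D h f' ≤ empRisk x h f + divergence (thresholdClass H) (empMeasure x) (empMeasure y) +
      ghostGap D (thresholdClass H) y + empRisk x f f' := by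
  have := nonempty_thresholdClass hf'
  linarith [risk_sub_empRisk_le_ghostGap hH hm hM D hh hf' hn y, empRisk_triangle x h f' f,
    empRisk_sub_empRisk_le_sampleGap hH hh hf' y x, sampleGap_le_divergence hm y x]

end

/-! ### The tail bound -/

theorem map_sample_eq_pi {Ω : Type*} [MeasurableSpace X] [MeasurableSpace Ω] {P : Measure Ω}
    [IsProbabilityMeasure P] {D : Measure X} {n : ℕ} {x : Fin n → Ω → X}
    (hx : ∀ i, HasLaw (x i) D P) (hi : iIndepFun x P) :
    P.map (fun ω i => x i ω) = Measure.pi fun _ => D := by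
  rw [(iIndepFun_iff_map_fun_eq_pi_map fun i => (hx i).aemeasurable).1 hi]
  simp only [fun i => (hx i).map_eq]

theorem hasSubgaussianMGF_comp_sample {Ω : Type*} [MeasurableSpace X] [MeasurableSpace Ω]
    {P : Measure Ω} [IsProbabilityMeasure P] {D : Measure X} {n : ℕ} {x : Fin n → Ω → X}
    (hx : ∀ i, HasLaw (x i) D P) (hi : iIndepFun x P) {f : (Fin n → X) → ℝ} {c : NNReal}
    (hf : HasSubgaussianMGF f c (Measure.pi fun _ => D)) :
    HasSubgaussianMGF (fun ω => f (x · ω)) c P := by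
  rw [← map_sample_eq_pi hx hi] at hf
  exact hf.of_map (aemeasurable_pi_lambda _ fun i => (hx i).aemeasurable)

/-- The tail of a sub-Gaussian variable with variance proxy at most `20 / n` at the level
`7 * √(log (1 / δ) / n)`; the constant only has to satisfy `2 * 20 ≤ 7 ^ 2`. -/
theorem measure_ge_le_of_hasSubgaussianMGF {Ω : Type*} [MeasurableSpace Ω] {P : Measure Ω}
    [IsProbabilityMeasure P] {Z : Ω → ℝ} {c : NNReal} (hZ : HasSubgaussianMGF Z c P) {n : ℕ}
    (hn : n ≠ 0) (hc0 : 0 < c) (hc : (c : ℝ) ≤ 20 / n) {δ : ℝ} (hδ0 : 0 < δ) (hδ1 : δ < 1) :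
    P {ω | 7 * √(Real.log (1 / δ) / n) ≤ Z ω} ≤ ENNReal.ofReal δ := by
  have hn' : (0 : ℝ) < n := by exact_mod_cast Nat.pos_of_ne_zero hn
  have hL : 0 < Real.log (1 / δ) := Real.log_pos (by rwa [lt_div_iff₀ hδ0, one_mul])
  have hc0' : (0 : ℝ) < c := by exact_mod_cast hc0
  rw [← ENNReal.ofReal_toReal (measure_ne_top P _)]
  refine ENNReal.ofReal_le_ofReal ((hZ.measure_ge_le (by positivity)).trans ?_)
  rw [← Real.le_log_iff_exp_le hδ0, neg_div, neg_le, ← Real.log_inv, ← one_div,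
    le_div_iff₀ (by positivity), mul_pow, Real.sq_sqrt (by positivity)]
  calc Real.log (1 / δ) * (2 * c) ≤ Real.log (1 / δ) * (2 * (20 / n)) := by gcongr
    _ = 40 * (Real.log (1 / δ) / n) := by ring
    _ ≤ 7 ^ 2 * (Real.log (1 / δ) / n) := by gcongr; norm_num

end DomainAdaptation

theorem mainTheorem4 :
    ∃ C : ℝ, 0 < C ∧
      ∀ (X : Type*) [MeasurableSpace X]
        -- the two domains and the hypothesis class
        (DS DT : Measure X) [IsProbabilityMeasure DS] [IsProbabilityMeasure DT]
        (H : Set (X → ℝ)) (fS fT : X → ℝ)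
        (_ : ∀ h ∈ H, ∀ x, h x ∈ Set.Icc (0 : ℝ) 1)
        (_ : fS ∈ H) (_ : fT ∈ H)
        (_ : ∀ h ∈ H, Measurable h) (_ : MeasurableClass (thresholdClass H))
        -- an i.i.d. sample of size `n` from each domain
        (Ω : Type*) [MeasurableSpace Ω] (P : Measure Ω) [IsProbabilityMeasure P]
        (n : ℕ) (_ : 1 ≤ n) (xS xT : Fin n → Ω → X)
        (_ : ∀ i, HasLaw (xS i) DS P) (_ : iIndepFun xS P)
        (_ : ∀ i, HasLaw (xT i) DT P) (_ : iIndepFun xT P)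
        (δ : ℝ) (_ : 0 < δ) (_ : δ < 1),
        P {ω | ¬ ∀ h ∈ H,
            -- the complexities on the pooled sample of size `2 * n`
            risk DT h fT ≤ empRisk (xS · ω) h fS
              + divergence (thresholdClass H) (empMeasure (xS · ω)) (empMeasure (xT · ω))
              + 2 * rademacher H (Sum.elim (xS · ω) (xT · ω))
              + 4 * rademacher (thresholdClass H) (Sum.elim (xS · ω) (xT · ω))
              + min (∫ x, |fS x - fT x| ∂DS) (∫ x, |fS x - fT x| ∂DT)
              + C * √(Real.log (1 / δ) / n) ∧
            -- the complexities on the two samples of size `n`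
            risk DT h fT ≤ empRisk (xS · ω) h fS
              + divergence (thresholdClass H) (empMeasure (xS · ω)) (empMeasure (xT · ω))
              + 2 * rademacher H (xS · ω)
              + (2 * rademacher (thresholdClass H) (xS · ω)
                + 2 * rademacher (thresholdClass H) (xT · ω))
              + min (∫ x, |fS x - fT x| ∂DS) (∫ x, |fS x - fT x| ∂DT)
              + C * √(Real.log (1 / δ) / n)}
          ≤ ENNReal.ofReal δ := by 
  refine ⟨7, by norm_num, ?_⟩
  intro X _ DS DT _ _ H fS fT hH hfS hfT hm hM Ω _ P _ n hn xS xT hlS hiS hlT hiT δ hδ0 hδ1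
  have hn0 : n ≠ 0 := by lia
  have hnR : (0 : ℝ) < n := by exact_mod_cast hn
  have hthr := nonempty_thresholdClass hfS
  have hne : Nonempty H := ⟨⟨fS, hfS⟩⟩
  have h01 : ∀ g ∈ thresholdClass H, ∀ x, g x ∈ Set.Icc (0 : ℝ) 1 :=
    fun _ hg => thresholdClass_mem_Icc hg
  set m := ∫ y, (ghostGap DT (thresholdClass H) y - 2 * rademacher (thresholdClass H) y)
    ∂(Measure.pi fun _ : Fin n => DT) with hm_def
  have hm0 : m ≤ 0 := integral_ghostGap_sub_nonpos h01 hM DT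
  have hZT := hasSubgaussianMGF_comp_sample hlT hiT
    (hasSubgaussianMGF_ghostGap_sub h01 hM DT (n := n))
  have hZS := hasSubgaussianMGF_comp_sample hlS hiS
    (hasSubgaussianMGF_empRisk_sub DS (hm fS hfS) (hm fT hfT) (hH fS hfS) (hH fT hfT) hn0)
  have hcT : ((n * (3 / n) ^ 2 : NNReal) : ℝ) = 9 / n := by
    push_cast
    field_simp
    norm_num
  have hcS : ((n * (1 / n) ^ 2 : NNReal) : ℝ) = 1 / n := by
    push_cast
    field_simp
  have hcT0 : 0 < (n * (3 / n) ^ 2 : NNReal) := by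
    rw [← NNReal.coe_pos, hcT]
    positivity
  have hRH (ω : Ω) := rademacher_nonneg hH (xS · ω)
  have hRHp (ω : Ω) := rademacher_nonneg hH (Sum.elim (xS · ω) (xT · ω))
  have hRS (ω : Ω) := rademacher_nonneg h01 (xS · ω)
  have hRp (ω : Ω) := rademacher_le_two_mul_pooled h01 (xS · ω) (xT · ω)
  -- the minimum is not random, so only the smaller of its two terms has to be attained
  rcases le_total (∫ x, |fS x - fT x| ∂DT) (∫ x, |fS x - fT x| ∂DS) with hle | hle
  · refine (measure_mono fun ω hω => ?_).trans (measure_ge_le_of_hasSubgaussianMGF hZT hn0 hcT0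
      (by rw [hcT]; gcongr; norm_num) hδ0 hδ1)
    rw [Set.mem_ofPred_eq] at hω ⊢
    by_contra! hlt
    refine hω fun h hh => ?_
    have hdet := risk_le_of_target hH hm hM DT hh hfS hfT hn0 (xS · ω) (xT · ω)
    have hrisk : risk DT fS fT = ∫ x, |fS x - fT x| ∂DT := rfl
    rw [min_eq_right hle]
    constructor <;> linarith [hRH ω, hRHp ω, hRS ω, hRp ω]
  · refine (measure_mono fun ω hω => ?_).trans (measure_ge_le_of_hasSubgaussianMGF
      (hZT.add hZS) hn0 (by positivity) ?_ hδ0 hδ1)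
    · rw [Set.mem_ofPred_eq] at hω ⊢
      by_contra! hlt
      refine hω fun h hh => ?_
      have hdet := risk_le_of_source hH hm hM DT hh hfT hn0 (xS · ω) (xT · ω) (f := fS)
      have hrisk : risk DS fS fT = ∫ x, |fS x - fT x| ∂DS := rfl
      rw [min_eq_left hle]
      constructor <;> linarith [hRH ω, hRHp ω, hRS ω, hRp ω]
    · rw [NNReal.coe_pow, NNReal.coe_add]
      refine add_sq_le.trans_eq ?_
      rw [Real.coe_sqrt, Real.coe_sqrt, Real.sq_sqrt (NNReal.coe_nonneg _),
        Real.sq_sqrt (NNReal.coe_nonneg _), hcT, hcS]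
      ring
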